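/- Let $n\ge 0$ and $\gamma\ge 1$ be integers, $[n]=\{1,\dots,n\}$, $u_0>0$ and $u_1,\dots,u_n\ge 0$ reals. For $\mathcal S\subseteq[n]$ put $u(\mathcal S)=\sum_{j\in\mathcal S}u_j$, $$\Phi(\mathcal S)=\max\Big\{\tfrac{u(\mathcal S')}{u(\mathcal S')+u_0}:\mathcal S'\subseteq\mathcal S,\ |\mathcal S'|\le\gamma\Big\},\qquad \rho_j(\mathcal S)=\Phi(\mathcal S\cup\{j\})-\Phi(\mathcal S).$$ Let $$\phi(x)=\max\Big\{\tfrac{\sum_{j}u_jy_j}{\sum_{j}u_jy_j+u_0}:\ \textstyle\sum_j y_j\le\gamma,\ y_j\le x_j,\ y_j\in[0,1]\ \forall j\in[n]\Big\},\qquad \mathcal X=\{(w,x)\in\mathbb R\times\{0,1\}^n: w\le\phi(x)\},$$ and, for disjoint $\mathcal S_0,\mathcal S_1\subseteq[n]$, let $\mathcal X(\mathcal S_0,\mathcal S_1)$ be the set of $(w,x)\in\mathcal X$ with $x_j=0$ for $j\in\mathcal S_0$ and $x_j=1$ for $j\in\mathcal S_1$. Fix $\mathcal S\subseteq[n]$ and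 let $s=|\mathcal S|$. (1) For every ordering $j_1,\dots,j_s$ of $\mathcal S$, the lifting coefficients $\eta_j$, $j\in\mathcal S$, are well defined (all maxima are attained) by $$\eta_{j_\ell}=\Phi(\mathcal S)-\sum_{\tau<\ell}\eta_{j_\tau}-\max\Big\{w-\sum_{j\in[n]\setminus\mathcal S}\rho_j(\mathcal S)x_j-\sum_{\tau<\ell}\eta_{j_\tau}x_{j_\tau}:(w,x)\in\mathcal X(\{j_\ell\},\{j_{\ell+1},\dots,j_s\})\Big\},\quad \ell=1,\dots,s.$$ They satisfy $\eta_j\ge\rho_j([n]\setminus\{j\})$ for all $j\in\mathcal S$, and the lifted submodular inequality $$w\le\Phi(\mathcal S)+\sum_{j\in[n]\setminus\mathcal S}\rho_j(\mathcal S)x_j-\sum_{j\in\mathcal S}\eta_j(1-x_j)$$ is at least as strong as the submodular inequality $$w\le\Phi(\mathcal S)+\sum_{j\in[n]\setminus\mathcal S}\rho_j(\mathcal S)x_j-\sum_{j\in\mathcal S}\rho_j([n]\setminus\{j\})(1-x_j),$$ that is, every $(w,x)\in\mathbb R\times[0,1]^n$ satisfying the former satisfies the latter. (2) For every ordering $j_1,\dots,j_{n-s}$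 of $[n]\setminus\mathcal S$, the lifting coefficients $\zeta_j$, $j\in[n]\setminus\mathcal S$, are well defined (all maxima are attained) by $$\zeta_{j_\ell}=-\Phi(\mathcal S)+\sum_{j\in\mathcal S}\rho_j(\mathcal S\setminus\{j\})+\max\Big\{w-\sum_{j\in\mathcal S}\rho_j(\mathcal S\setminus\{j\})x_j-\sum_{\tau<\ell}\zeta_{j_\tau}x_{j_\tau}:(w,x)\in\mathcal X(\{j_{\ell+1},\dots,j_{n-s}\},\{j_\ell\})\Big\},\quad \ell=1,\dots,n-s.$$ They satisfy $\zeta_j\le\rho_j(\varnothing)$ for all $j\in[n]\setminus\mathcal S$, and the lifted submodular inequality $$w\le\Phi(\mathcal S)-\sum_{j\in\mathcal S}\rho_j(\mathcal S\setminus\{j\})(1-x_j)+\sum_{j\in[n]\setminus\mathcal S}\zeta_jx_j$$ is at least as strong, in the same sense, as the submodular inequality $$w\le\Phi(\mathcal S)+\sum_{j\in[n]\setminus\mathcal S}\rho_j(\varnothing)x_j-\sum_{j\in\mathcal S}\rho_j(\mathcal S\setminus\{j\})(1-x_j).$$ -/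

import Mathlib

namespace LiftedSubmodular

noncomputable section

/-- The value `u(A) / (u(A) + u₀)` of a finite set `A` of facilities. -/
def share {n : ℕ} (u₀ : ℝ) (u : Fin n → ℝ) (A : Finset (Fin n)) : ℝ :=
  (∑ j ∈ A, u j) / ((∑ j ∈ A, u j) + u₀)

/-- The set function `Φ(S) = max { u(A) / (u(A) + u₀) : A ⊆ S, |A| ≤ γ }`. -/
def Phi {n : ℕ} (u₀ : ℝ) (u : Fin n → ℝ) (γ : ℕ) (S : Finset (Fin n)) : ℝ :=
  (S.powerset.filter fun A => A.card ≤ γ).sup'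
    ⟨∅, by simp⟩ (share u₀ u)

/-- The marginal gain `ρ_j(S) = Φ(S ∪ j) - Φ(S)`. -/
def rho {n : ℕ} (u₀ : ℝ) (u : Fin n → ℝ) (γ : ℕ) (j : Fin n) (S : Finset (Fin n)) : ℝ :=
  Phi u₀ u γ (insert j S) - Phi u₀ u γ S

/-- The function `φ(x)`: the maximum of `(∑ u_j y_j) / (∑ u_j y_j + u₀)` over all `y ∈ [0,1]^n`
with `∑ y_j ≤ γ` and `y_j ≤ x_j` for all `j`. (For `x ≥ 0`, `u ≥ 0`, `u₀ > 0` the feasible region is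
nonempty and compact, so that the supremum is a maximum.) -/
def phi {n : ℕ} (u₀ : ℝ) (u : Fin n → ℝ) (γ : ℕ) (x : Fin n → ℝ) : ℝ :=
  sSup {r : ℝ | ∃ y : Fin n → ℝ,
    (∑ j, y j ≤ (γ : ℝ)) ∧ (∀ j, y j ≤ x j) ∧ (∀ j, y j ∈ Set.Icc (0 : ℝ) 1) ∧
    r = (∑ j, u j * y j) / ((∑ j, u j * y j) + u₀)}

/-- The mixed 0-1 set `𝒳 = {(w, x) ∈ ℝ × {0,1}^n : w ≤ φ(x)}`. -/
def X {n : ℕ} (u₀ : ℝ) (u : Fin n → ℝ) (γ : ℕ) : Set (ℝ × (Fin n → ℝ)) :=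
  {p | (∀ j, p.2 j = 0 ∨ p.2 j = 1) ∧ p.1 ≤ phi u₀ u γ p.2}

/-- The restriction `𝒳(S₀, S₁)`: variables in `S₀` are fixed to `0`, those in `S₁` to `1`. -/
def XFix {n : ℕ} (u₀ : ℝ) (u : Fin n → ℝ) (γ : ℕ) (S₀ S₁ : Finset (Fin n)) :
    Set (ℝ × (Fin n → ℝ)) :=
  {p | p ∈ X u₀ u γ ∧ (∀ j ∈ S₀, p.2 j = 0) ∧ (∀ j ∈ S₁, p.2 j = 1)}

/-- `η` is the family of coefficients obtained by down-lifting the variables of `S`, in the order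
`σ 0, σ 1, …`, into the seed inequality `w ≤ Φ(S) + ∑_{j ∉ S} ρ_j(S) x_j`: for each position `ℓ`,
the lifting problem attains its maximum `ν` and `η_{σ ℓ} = Φ(S) - ∑_{τ < ℓ} η_{σ τ} - ν`. -/
def IsDownLifting {n : ℕ} (u₀ : ℝ) (u : Fin n → ℝ) (γ : ℕ) (S : Finset (Fin n))
    (σ : Fin S.card ≃ ↥S) (η : ↥S → ℝ) : Prop :=
  ∀ ℓ : Fin S.card, ∃ ν : ℝ,
    IsGreatest
      ((fun p : ℝ × (Fin n → ℝ) =>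
          p.1 - ∑ j ∈ Sᶜ, rho u₀ u γ j S * p.2 j
            - ∑ τ ∈ Finset.Iio ℓ, η (σ τ) * p.2 (σ τ)) ''
        XFix u₀ u γ {(σ ℓ : Fin n)} ((Finset.Ioi ℓ).image fun τ => (σ τ : Fin n))) ν ∧
    η (σ ℓ) = Phi u₀ u γ S - ∑ τ ∈ Finset.Iio ℓ, η (σ τ) - ν

/-- `ζ` is the family of coefficients obtained by up-lifting the variables outside `S`, in the order
`σ 0, σ 1, …`, into the seed inequality `w ≤ Φ(S) - ∑_{j ∈ S} ρ_j(S \ j) (1 - x_j)`: for each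
position `ℓ`, the lifting problem attains its maximum `ν` and
`ζ_{σ ℓ} = -Φ(S) + ∑_{j ∈ S} ρ_j(S \ j) + ν`. -/
def IsUpLifting {n : ℕ} (u₀ : ℝ) (u : Fin n → ℝ) (γ : ℕ) (S : Finset (Fin n))
    (σ : Fin (Sᶜ).card ≃ ↥(Sᶜ)) (ζ : ↥(Sᶜ) → ℝ) : Prop :=
  ∀ ℓ : Fin (Sᶜ).card, ∃ ν : ℝ,
    IsGreatest
      ((fun p : ℝ × (Fin n → ℝ) =>
          p.1 - ∑ j ∈ S, rho u₀ u γ j (S.erase j) * p.2 j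
            - ∑ τ ∈ Finset.Iio ℓ, ζ (σ τ) * p.2 (σ τ)) ''
        XFix u₀ u γ ((Finset.Ioi ℓ).image fun τ => (σ τ : Fin n)) {(σ ℓ : Fin n)}) ν ∧
    ζ (σ ℓ) = -Phi u₀ u γ S + ∑ j ∈ S, rho u₀ u γ j (S.erase j) + ν

/-- The first submodular inequality defined by `S`, at the point `(w, x)`. -/
def SI1 {n : ℕ} (u₀ : ℝ) (u : Fin n → ℝ) (γ : ℕ) (S : Finset (Fin n))
    (w : ℝ) (x : Fin n → ℝ) : Prop :=
  w ≤ Phi u₀ u γ S + ∑ j ∈ Sᶜ, rho u₀ u γ j S * x j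
    - ∑ j ∈ S, rho u₀ u γ j (Finset.univ.erase j) * (1 - x j)

/-- The second submodular inequality defined by `S`, at the point `(w, x)`. -/
def SI2 {n : ℕ} (u₀ : ℝ) (u : Fin n → ℝ) (γ : ℕ) (S : Finset (Fin n))
    (w : ℝ) (x : Fin n → ℝ) : Prop :=
  w ≤ Phi u₀ u γ S + ∑ j ∈ Sᶜ, rho u₀ u γ j ∅ * x j
    - ∑ j ∈ S, rho u₀ u γ j (S.erase j) * (1 - x j)

/-- The first lifted submodular inequality, with lifting coefficients `η`. -/
def LiftedSI1 {n : ℕ} (u₀ : ℝ) (u : Fin n → ℝ) (γ : ℕ) (S : Finset (Fin n)) (η : ↥S → ℝ)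
    (w : ℝ) (x : Fin n → ℝ) : Prop :=
  w ≤ Phi u₀ u γ S + ∑ j ∈ Sᶜ, rho u₀ u γ j S * x j - ∑ j : ↥S, η j * (1 - x j)

/-- The second lifted submodular inequality, with lifting coefficients `ζ`. -/
def LiftedSI2 {n : ℕ} (u₀ : ℝ) (u : Fin n → ℝ) (γ : ℕ) (S : Finset (Fin n)) (ζ : ↥(Sᶜ) → ℝ)
    (w : ℝ) (x : Fin n → ℝ) : Prop :=
  w ≤ Phi u₀ u γ S - ∑ j ∈ S, rho u₀ u γ j (S.erase j) * (1 - x j) + ∑ j : ↥(Sᶜ), ζ j * x j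

/-- The inequality `P` is at least as strong as the inequality `Q`: every point of
`ℝ × [0,1]^n` that satisfies `P` satisfies `Q`. -/
def AtLeastAsStrong {n : ℕ} (P Q : ℝ → (Fin n → ℝ) → Prop) : Prop :=
  ∀ (w : ℝ) (x : Fin n → ℝ), (∀ j, x j ∈ Set.Icc (0 : ℝ) 1) → P w x → Q w x

end

end LiftedSubmodular

/-!
Let `g T` be the amount by which the point `(Φ(T), 1_T)` violates the seed inequality. Both lifting
procedures then read `c ℓ = max (g T - ∑ c τ)`, where `T` ranges over the sets whose last variable
moved away from its seed value is `ℓ`, and the sum over the variables of `T` moved before (for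
down-lifting `c = -η`). Comparing `g T` with the coefficient of the last moved variable shows that
the lifted inequality is valid; at a maximizer `T` of the `ℓ`-th problem it is tight, so its
validity after moving `ℓ` back bounds `c ℓ` by a marginal gain of `Φ`, which submodularity of `Φ`
compares with the extreme one.

`Φ` is submodular because it is the increasing concave function `t ↦ t / (t + u₀)` of the maximal
weight of a subset of cardinality at most `γ`, which is submodular by an exchange argument.
-/

namespace LiftedSubmodular

open Finset

section Submodular

variable {α R : Type*} [DecidableEq α] [AddCommGroup R]

/-- The marginal gain of the element `j` over the set `A` under a set function `f`; `rho` is the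
marginal gain under `Phi`. -/
def marginal (f : Finset α → R) (j : α) (A : Finset α) : R :=
  f (insert j A) - f A

variable [PartialOrder R]

/-- Submodularity of a set function, in the form of diminishing marginal gains. -/
def IsSubmodular (f : Finset α → R) : Prop :=
  ∀ ⦃A B : Finset α⦄, A ⊆ B → ∀ j ∉ B, marginal f j B ≤ marginal f j A

variable [IsOrderedAddMonoid R] {f : Finset α → R}

lemma IsSubmodular.union_le_add_sum_marginal (hf : IsSubmodular f) {A C : Finset α}
    (hAC : Disjoint A C) : f (A ∪ C) ≤ f A + ∑ j ∈ C, marginal f j A := by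
  induction C using Finset.induction_on with
  | empty => simp
  | insert a C ha ih =>
    rw [disjoint_insert_right] at hAC
    have hgain := hf subset_union_left a (notMem_union.2 ⟨hAC.1, ha⟩)
    calc f (A ∪ insert a C) = marginal f a (A ∪ C) + f (A ∪ C) := by
          rw [union_insert, marginal, sub_add_cancel]
      _ ≤ marginal f a A + (f A + ∑ j ∈ C, marginal f j A) := add_le_add hgain (ih hAC.2)
      _ = f A + ∑ j ∈ insert a C, marginal f j A := by rw [sum_insert ha, add_left_comm]

lemma IsSubmodular.add_sum_marginal_erase_le_union (hf : IsSubmodular f) {A B C : Finset α}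
    (hAC : Disjoint A C) (hB : A ∪ C ⊆ B) :
    f A + ∑ j ∈ C, marginal f j (B.erase j) ≤ f (A ∪ C) := by
  induction C using Finset.induction_on with
  | empty => simp
  | insert a C ha ih =>
    rw [disjoint_insert_right] at hAC
    rw [union_insert] at hB ⊢
    have hsub : A ∪ C ⊆ B.erase a :=
      subset_erase.2 ⟨(subset_insert _ _).trans hB, notMem_union.2 ⟨hAC.1, ha⟩⟩
    calc f A + ∑ j ∈ insert a C, marginal f j (B.erase j)
        = marginal f a (B.erase a) + (f A + ∑ j ∈ C, marginal f j (B.erase j)) := by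
          rw [sum_insert ha, add_left_comm]
      _ ≤ marginal f a (A ∪ C) + f (A ∪ C) :=
          add_le_add (hf hsub a (notMem_erase a B)) (ih hAC.2 (hsub.trans (erase_subset a B)))
      _ = f (insert a (A ∪ C)) := by rw [marginal, sub_add_cancel]

end Submodular

section ConcaveComp

variable {𝕜 : Type*} [Field 𝕜] [LinearOrder 𝕜] [IsStrictOrderedRing 𝕜] {s : Set 𝕜} {g : 𝕜 → 𝕜}

lemma add_le_add_of_concaveOn (hg : ConcaveOn 𝕜 s g) {a b x y : 𝕜} (ha : a ∈ s) (hb : b ∈ s)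
    (hx : x ∈ Set.Icc a b) (hxy : x + y = a + b) : g a + g b ≤ g x + g y := by
  obtain ⟨p, q, hp, hq, hpq, rfl⟩ := (Convex.mem_Icc (hx.1.trans hx.2)).1 hx
  have hy : y = q * a + p * b := by linear_combination hxy - (a + b) * hpq
  have hgx := hg.2 ha hb hp hq hpq
  have hgy := hg.2 ha hb hq hp (by rwa [add_comm])
  simp only [smul_eq_mul, ← hy] at hgx hgy
  calc g a + g b = (p * g a + q * g b) + (q * g a + p * g b) := by
        linear_combination -(g a + g b) * hpq
    _ ≤ g (p * a + q * b) + g y := add_le_add hgx hgy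

/-- The concave function may increase at most as much from `f B` as from `f A ≤ f B`, and
monotonicity absorbs the decrease of the marginal gain. -/
lemma IsSubmodular.concaveOn_comp {α : Type*} [DecidableEq α] {f : Finset α → 𝕜}
    (hf : IsSubmodular f) (hmono : Monotone f) (hs : IsUpperSet s) (hfs : ∀ A, f A ∈ s)
    (hg : ConcaveOn 𝕜 s g) (hgmono : MonotoneOn g s) : IsSubmodular fun A => g (f A) := by
  intro A B hAB j hj
  have hgain : f (insert j B) ≤ f B + marginal f j A := by
    have := hf hAB j hj
    rw [marginal] at this
    linarith
  have hnonneg : 0 ≤ marginal f j A := sub_nonneg.2 (hmono (subset_insert j A))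
  have hmem : f B + marginal f j A ∈ s := hs (le_add_of_nonneg_right hnonneg) (hfs B)
  have hle := add_le_add_of_concaveOn hg (hfs A) hmem
    ⟨hmono hAB, le_add_of_nonneg_right hnonneg⟩ (y := f (insert j A)) (by rw [marginal]; ring)
  have hle' := hgmono (hfs _) hmem hgain
  simp only [marginal] at hle hle' ⊢
  linarith

lemma monotoneOn_div_add_const {c : 𝕜} (hc : 0 < c) :
    MonotoneOn (fun t => t / (t + c)) (Set.Ici 0) := by
  intro s (hs : 0 ≤ s) t (ht : 0 ≤ t) hst
  rw [div_le_div_iff₀ (by positivity) (by positivity)]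
  linarith [mul_le_mul_of_nonneg_right hst hc.le]

lemma concaveOn_div_add_const {c : 𝕜} (hc : 0 < c) :
    ConcaveOn 𝕜 (Set.Ici 0) fun t => t / (t + c) := by
  have hinv : ConvexOn 𝕜 (Set.Ici 0) fun t => (t + c)⁻¹ := by
    refine (((convexOn_zpow (𝕜 := 𝕜) (-1)).translate_left c).subset (fun t ht => ?_)
      (convex_Ici 0)).congr fun t _ => ?_
    · exact add_pos_of_pos_of_nonneg hc ht
    · simp
  refine ((concaveOn_const 1 (convex_Ici 0)).sub (hinv.smul hc.le)).congr fun t ht => ?_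
  have hne : t + c ≠ 0 := (add_pos_of_nonneg_of_pos ht hc).ne'
  simp only [Pi.sub_apply, smul_eq_mul]
  field_simp
  ring

end ConcaveComp

section MaxWeight

variable {α R : Type*} {γ : ℕ}

/-- Either `j` alone can be moved from `P` to `Q`, or it is exchanged for an element of `Q`. -/
lemma exists_exchange [DecidableEq α] [AddCommMonoid R] (u : α → R) {P Q : Finset α} (hP : #P ≤ γ)
    (hQ : #Q ≤ γ) {j : α} (hjP : j ∈ P) (hjQ : j ∉ Q) :
    ∃ P' ⊆ P.erase j ∪ Q, ∃ Q' ⊆ insert j Q, #P' ≤ γ ∧ #Q' ≤ γ ∧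
      ∑ i ∈ P', u i + ∑ i ∈ Q', u i = ∑ i ∈ P, u i + ∑ i ∈ Q, u i := by
  have hcardP := card_erase_add_one hjP
  by_cases hlt : #Q < γ
  · refine ⟨P.erase j, subset_union_left, insert j Q, subset_rfl, by omega,
      by rw [card_insert_of_notMem hjQ]; omega, ?_⟩
    rw [sum_insert hjQ, ← add_sum_erase P u hjP]
    abel
  · obtain ⟨k, hkQ, hkP⟩ : ∃ k ∈ Q, k ∉ P.erase j :=
      exists_mem_notMem_of_card_lt_card (by omega)
    have hjQ' : j ∉ Q.erase k := fun hj => hjQ (mem_of_mem_erase hj)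
    have hcardQ := card_erase_add_one hkQ
    refine ⟨insert k (P.erase j), insert_subset (mem_union_right _ hkQ) subset_union_left,
      insert j (Q.erase k), insert_subset_insert j (erase_subset k Q),
      by rw [card_insert_of_notMem hkP]; omega, by rw [card_insert_of_notMem hjQ']; omega, ?_⟩
    rw [sum_insert hkP, sum_insert hjQ', ← add_sum_erase P u hjP, ← add_sum_erase Q u hkQ]
    abel

section AddCommMonoid

variable [AddCommMonoid R] [LinearOrder R] {u : α → R} {A S : Finset α}

/-- The largest weight `u(A)` of a set `A ⊆ S` with at most `γ` elements, so that `Φ(S)` is the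
value of `t ↦ t / (t + u₀)` at it. -/
def maxWeight (u : α → R) (γ : ℕ) (S : Finset α) : R :=
  (S.powerset.filter fun A => #A ≤ γ).sup' ⟨∅, by simp⟩ fun A => ∑ j ∈ A, u j

lemma sum_le_maxWeight (hA : A ⊆ S) (hcard : #A ≤ γ) : ∑ j ∈ A, u j ≤ maxWeight u γ S :=
  le_sup' (fun A => ∑ j ∈ A, u j) (by simp [hA, hcard])

lemma exists_sum_eq_maxWeight (u : α → R) (γ : ℕ) (S : Finset α) :
    ∃ A ⊆ S, #A ≤ γ ∧ ∑ j ∈ A, u j = maxWeight u γ S := by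
  obtain ⟨A, hA, h⟩ := exists_mem_eq_sup' (s := S.powerset.filter fun A => #A ≤ γ)
    ⟨∅, by simp⟩ (fun A => ∑ j ∈ A, u j)
  rw [mem_filter, mem_powerset] at hA
  exact ⟨A, hA.1, hA.2, h.symm⟩

lemma maxWeight_nonneg (S : Finset α) : 0 ≤ maxWeight u γ S := by
  simpa using sum_le_maxWeight (u := u) (γ := γ) (empty_subset S) (by simp)

lemma monotone_maxWeight : Monotone (maxWeight u γ) := by
  intro S T hST
  obtain ⟨A, hA, hcard, hsum⟩ := exists_sum_eq_maxWeight u γ S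
  exact hsum ▸ sum_le_maxWeight (hA.trans hST) hcard

end AddCommMonoid

section AddCommGroup

variable [DecidableEq α] [AddCommGroup R] [LinearOrder R] [IsOrderedAddMonoid R]

lemma isSubmodular_maxWeight (u : α → R) (γ : ℕ) : IsSubmodular (maxWeight u γ) := by
  intro A B hAB j hjB
  rw [marginal, marginal, sub_le_sub_iff]
  obtain ⟨P, hP, hcardP, hsumP⟩ := exists_sum_eq_maxWeight u γ (insert j B)
  obtain ⟨Q, hQ, hcardQ, hsumQ⟩ := exists_sum_eq_maxWeight u γ A
  by_cases hjP : j ∈ P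
  · obtain ⟨P', hP', Q', hQ', hcardP', hcardQ', hsum⟩ :=
      exists_exchange u hcardP hcardQ hjP fun hjQ => hjB (hAB (hQ hjQ))
    have hP'B : P' ⊆ B := hP'.trans (union_subset (subset_insert_iff.1 hP) (hQ.trans hAB))
    have hQ'A : Q' ⊆ insert j A := hQ'.trans (insert_subset_insert j hQ)
    rw [← hsumP, ← hsumQ, ← hsum, add_comm]
    exact add_le_add (sum_le_maxWeight hQ'A hcardQ') (sum_le_maxWeight hP'B hcardP')
  · have hPB : P ⊆ B := (subset_insert_iff_of_notMem hjP).1 hP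
    rw [← hsumP, add_comm]
    exact add_le_add (monotone_maxWeight (subset_insert j A)) (sum_le_maxWeight hPB hcardP)

/-- The threshold `c` is an optimal dual multiplier of the constraint `#A ≤ γ`. -/
lemma exists_threshold (u : α → R) (γ : ℕ) (T : Finset α) :
    ∃ A ⊆ T, #A ≤ γ ∧ ∃ c, 0 ≤ c ∧ (#A < γ → c = 0) ∧ (∀ a ∈ A, c ≤ u a) ∧
      ∀ b ∈ T \ A, u b ≤ c := by
  obtain ⟨A, hAT, hcard, hsum⟩ := exists_sum_eq_maxWeight u γ T
  have hmax : ∀ A' ⊆ T, #A' ≤ γ → ∑ j ∈ A', u j ≤ ∑ j ∈ A, u j :=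
    fun A' hA' hcard' => hsum ▸ sum_le_maxWeight hA' hcard'
  have hremove : ∀ a ∈ A, 0 ≤ u a := fun a ha => by
    have := hmax (A.erase a) ((erase_subset a A).trans hAT) (card_erase_le.trans hcard)
    rwa [← add_sum_erase A u ha, le_add_iff_nonneg_left] at this
  have hadd : #A < γ → ∀ b ∈ T \ A, u b ≤ 0 := fun hlt b hb => by
    rw [mem_sdiff] at hb
    have := hmax (insert b A) (insert_subset hb.1 hAT) ((card_insert_le b A).trans hlt)
    rwa [sum_insert hb.2, add_le_iff_nonpos_left] at this
  have hswap : ∀ a ∈ A, ∀ b ∈ T \ A, u b ≤ u a := fun a ha b hb => by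
    rw [mem_sdiff] at hb
    have hb' : b ∉ A.erase a := fun h => hb.2 (mem_of_mem_erase h)
    have := hmax (insert b (A.erase a)) (insert_subset hb.1 ((erase_subset a A).trans hAT))
      (by rwa [card_insert_of_notMem hb', card_erase_add_one ha])
    rwa [sum_insert hb', ← add_sum_erase A u ha, add_le_add_iff_right] at this
  refine ⟨A, hAT, hcard, ?_⟩
  rcases (T \ A).eq_empty_or_nonempty with hempty | hne
  · exact ⟨0, le_rfl, fun _ => rfl, hremove, by simp [hempty]⟩
  · obtain ⟨b, hb, hbmax⟩ := exists_max_image (T \ A) u hne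
    exact ⟨max 0 (u b), le_max_left _ _, fun hlt => max_eq_left (hadd hlt b hb),
      fun a ha => max_le (hremove a ha) (hswap a ha b hb),
      fun b' hb' => le_max_of_le_right (hbmax b' hb')⟩

end AddCommGroup

lemma sum_mul_le_maxWeight [CommRing R] [LinearOrder R] [IsStrictOrderedRing R] {u y : α → R}
    {T : Finset α} (hy : ∀ j ∈ T, y j ∈ Set.Icc 0 1) (hsum : ∑ j ∈ T, y j ≤ γ) :
    ∑ j ∈ T, u j * y j ≤ maxWeight u γ T := by
  classical
  obtain ⟨A, hAT, hcard, c, hc, hslack, hA, hTA⟩ := exists_threshold u γ T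
  have hterm : ∀ j ∈ T, u j * y j ≤ (if j ∈ A then u j - c else 0) + c * y j := by
    intro j hj
    split_ifs with hjA
    · nlinarith [hA j hjA, (hy j hj).2]
    · rw [zero_add]
      exact mul_le_mul_of_nonneg_right (hTA j (mem_sdiff.2 ⟨hj, hjA⟩)) (hy j hj).1
  have hcompl : c * #A = c * γ := by
    rcases hcard.lt_or_eq with hlt | heq
    · simp [hslack hlt]
    · rw [heq]
  calc ∑ j ∈ T, u j * y j ≤ ∑ j ∈ T, ((if j ∈ A then u j - c else 0) + c * y j) :=
        sum_le_sum hterm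
    _ = ∑ j ∈ A, u j - c * #A + c * ∑ j ∈ T, y j := by
        rw [sum_add_distrib, sum_ite_mem, inter_eq_right.2 hAT, sum_sub_distrib, sum_const,
          nsmul_eq_mul, mul_comm c (#A : R), mul_sum]
    _ ≤ ∑ j ∈ A, u j := by linarith [mul_le_mul_of_nonneg_left hsum hc]
    _ ≤ maxWeight u γ T := sum_le_maxWeight hAT hcard

end MaxWeight

section Recursion

lemma exists_isGreatest_image {β R : Type*} [Finite β] [LinearOrder R] (f : β → R) {s : Set β}
    (hs : s.Nonempty) : ∃ ν, IsGreatest (f '' s) ν := by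
  obtain ⟨a, ha, hmax⟩ := Set.exists_max_image s f s.toFinite hs
  exact ⟨f a, Set.mem_image_of_mem f ha, Set.forall_mem_image.2 hmax⟩

lemma existsUnique_of_wellFoundedLT_recursion {ι β : Type*} [LT ι] [WellFoundedLT ι] [Nonempty β]
    {F : ι → (ι → β) → β} (hF : ∀ i f g, (∀ k < i, f k = g k) → F i f = F i g) :
    ∃! f : ι → β, ∀ i, f i = F i f := by
  classical
  inhabit β
  let f : ι → β := WellFoundedLT.fix fun i r => F i fun k => if h : k < i then r k h else default
  have hf : ∀ i, f i = F i f := fun i => by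
    refine (WellFoundedLT.fix_eq _ i).trans (hF i _ _ fun k hk => ?_)
    rw [dif_pos hk]
  refine ⟨f, hf, fun g hg => funext fun i => ?_⟩
  induction i using WellFoundedLT.induction with
  | ind i ih => rw [hg i, hf i]; exact hF i _ _ ih

end Recursion

section Lifting

variable {ι Ω R : Type*} [LinearOrder ι] [AddCommGroup R]

/-- Abstract sequential lifting of the inequality `g T ≤ 0`. A point `T : Ω` has excess `g T` over
the seed inequality and moves the variables in `A T` away from their seed values; the `ℓ`-th
lifting problem ranges over the points at which `ℓ` is the last variable moved. The lifted
inequality is `g T ≤ ∑ τ ∈ A T, c τ`. -/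
def IsLifting [LE R] (g : Ω → R) (A : Ω → Finset ι) (c : ι → R) : Prop :=
  ∀ ℓ, IsGreatest ((fun T => g T - ∑ τ ∈ (A T).erase ℓ, c τ) ''
    {T | IsGreatest (A T : Set ι) ℓ}) (c ℓ)

theorem existsUnique_isLifting [LinearOrder R] [WellFoundedLT ι] [Finite Ω] (g : Ω → R)
    {A : Ω → Finset ι} (hA : ∀ ℓ, ∃ T, IsGreatest (A T : Set ι) ℓ) : ∃! c, IsLifting g A c := by
  choose F hF using fun (ℓ : ι) (c : ι → R) =>
    exists_isGreatest_image (fun T => g T - ∑ τ ∈ (A T).erase ℓ, c τ) (hA ℓ)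
  have hrec : ∃! c : ι → R, ∀ ℓ, c ℓ = F ℓ c := by
    refine existsUnique_of_wellFoundedLT_recursion fun ℓ c d hcd => (hF ℓ c).unique ?_
    refine (Set.image_congr fun T hT => ?_) ▸ hF ℓ d
    refine congrArg (g T - ·) (sum_congr rfl fun τ hτ => (hcd τ ?_).symm)
    exact (hT.2 (mem_of_mem_erase hτ)).lt_of_ne (ne_of_mem_erase hτ)
  refine (existsUnique_congr fun c => forall_congr' fun ℓ => ⟨fun h => ?_, fun h => ?_⟩).1 hrec
  · exact h ▸ hF ℓ c
  · exact h.unique (hF ℓ c)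

variable [PartialOrder R] [IsOrderedAddMonoid R] {g : Ω → R} {A : Ω → Finset ι} {c : ι → R}

theorem IsLifting.le_sum (hc : IsLifting g A c) (hseed : ∀ T, A T = ∅ → g T ≤ 0) (T : Ω) :
    g T ≤ ∑ τ ∈ A T, c τ := by
  rcases (A T).eq_empty_or_nonempty with hempty | hne
  · simpa [hempty] using hseed T hempty
  · have hlast := (A T).isGreatest_max' hne
    rw [← add_sum_erase _ c hlast.1, ← sub_le_iff_le_add]
    exact (hc _).2 ⟨T, hlast, rfl⟩

/-- The lifted inequality is tight at a maximizer `T` of the `ℓ`-th lifting problem and valid at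
the point `T'` obtained from `T` by moving `ℓ` back to its seed value. -/
theorem IsLifting.coeff_le (hc : IsLifting g A c) (hseed : ∀ T, A T = ∅ → g T ≤ 0) {ℓ : ι} {b : R}
    (hback : ∀ T, ℓ ∈ A T → ∃ T', A T' = (A T).erase ℓ ∧ g T - g T' ≤ b) : c ℓ ≤ b := by
  obtain ⟨T, hT, htight⟩ := (hc ℓ).1
  obtain ⟨T', hA', hle⟩ := hback T hT.1
  have hvalid := hc.le_sum hseed T'
  rw [hA'] at hvalid
  exact htight ▸ (sub_le_sub_left hvalid _).trans hle

end Lifting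

section Seed

variable {α R : Type*} [DecidableEq α] [AddCommGroup R] {f : Finset α → R} {S T : Finset α} {j : α}

/-- The excess of the point `(f T, 1_T)` over the seed inequality
`w ≤ f S + ∑ j ∈ Sᶜ, marginal f j S * x j` of down-lifting. -/
def downExcess (f : Finset α → R) (S T : Finset α) : R :=
  f T - f S - ∑ j ∈ T \ S, marginal f j S

/-- The excess of the point `(f T, 1_T)` over the seed inequality
`w ≤ f S - ∑ j ∈ S, marginal f j (S.erase j) * (1 - x j)` of up-lifting. -/
def upExcess (f : Finset α → R) (S T : Finset α) : R :=
  f T - f S + ∑ j ∈ S \ T, marginal f j (S.erase j)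

lemma downExcess_sub_downExcess_insert (hj : j ∈ S) :
    downExcess f S T - downExcess f S (insert j T) = -marginal f j T := by
  rw [downExcess, downExcess, insert_sdiff_of_mem _ hj, marginal]
  abel

lemma upExcess_sub_upExcess_erase (hjS : j ∉ S) (hjT : j ∈ T) :
    upExcess f S T - upExcess f S (T.erase j) = marginal f j (T.erase j) := by
  have hsdiff : S \ T.erase j = S \ T := by grind
  rw [upExcess, upExcess, hsdiff, marginal, insert_erase hjT]
  abel

variable [PartialOrder R] [IsOrderedAddMonoid R]

lemma IsSubmodular.downExcess_nonpos (hf : IsSubmodular f) (hST : S ⊆ T) :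
    downExcess f S T ≤ 0 := by
  rw [downExcess, sub_sub, sub_nonpos]
  simpa [union_sdiff_of_subset hST] using
    hf.union_le_add_sum_marginal (disjoint_sdiff (s := S) (t := T))

lemma IsSubmodular.upExcess_nonpos (hf : IsSubmodular f) (hTS : T ⊆ S) : upExcess f S T ≤ 0 := by
  rw [upExcess, sub_add_eq_add_sub, sub_nonpos]
  simpa [union_sdiff_of_subset hTS] using
    hf.add_sum_marginal_erase_le_union (disjoint_sdiff (s := T) (t := S))
      (union_sdiff_of_subset hTS).subset

end Seed

section Incidence

variable {α ι : Type*}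

/-- The incidence vector `1_T` of a finite set, through which the 0-1 points of `X` become sets. -/
noncomputable def incidence (T : Finset α) : α → ℝ :=
  (T : Set α).indicator 1

lemma exists_incidence_eq [Finite α] {x : α → ℝ} (hx : ∀ j, x j = 0 ∨ x j = 1) :
    ∃ T, incidence T = x := by
  refine ⟨(Set.toFinite {j | x j = 1}).toFinset, funext fun j => ?_⟩
  rcases hx j with h | h <;> simp [incidence, h]

variable [DecidableEq α]

lemma sum_mul_incidence (s T : Finset α) (a : α → ℝ) :
    ∑ j ∈ s, a j * incidence T j = ∑ j ∈ s ∩ T, a j := by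
  simp [incidence, Set.indicator_apply]

lemma downExcess_eq_sub_sum_mul_incidence [Fintype α] (f : Finset α → ℝ) (S T : Finset α) :
    downExcess f S T = f T - ∑ j ∈ Sᶜ, marginal f j S * incidence T j - f S := by
  rw [downExcess, sum_mul_incidence, inter_comm, ← sdiff_eq_inter_compl]
  ring

lemma upExcess_eq_sub_sum_mul_incidence (f : Finset α → ℝ) (S T : Finset α) :
    upExcess f S T = f T - ∑ j ∈ S, marginal f j (S.erase j) * incidence T j
      - (f S - ∑ j ∈ S, marginal f j (S.erase j)) := by
  rw [upExcess, sum_mul_incidence, ← sum_inter_add_sum_sdiff S T]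
  ring

/-- The indices whose value under an enumeration `e` lies in `T`. Up-lifting moves the variables in
`positions e T`, down-lifting those in `positions e Tᶜ`. -/
def positions [Fintype ι] (e : ι → α) (T : Finset α) : Finset ι :=
  univ.filter fun τ => e τ ∈ T

variable [Fintype ι] {e : ι → α} {T : Finset α}

lemma mem_positions {τ : ι} : τ ∈ positions e T ↔ e τ ∈ T := by
  simp [positions]

lemma positions_erase [DecidableEq ι] (he : e.Injective) (T : Finset α) (ℓ : ι) :
    positions e (T.erase (e ℓ)) = (positions e T).erase ℓ := by
  ext τ
  simp only [mem_positions, mem_erase, he.ne_iff]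

variable [LinearOrder ι] {ℓ : ι}

lemma isGreatest_positions_singleton (he : e.Injective) (ℓ : ι) :
    IsGreatest (positions e {e ℓ} : Set ι) ℓ :=
  ⟨by simp [mem_positions], fun τ hτ => (he (by simpa [mem_positions] using hτ)).le⟩

lemma isGreatest_positions_iff [LocallyFiniteOrderTop ι] :
    IsGreatest (positions e T : Set ι) ℓ ↔ e ℓ ∈ T ∧ Disjoint ((Ioi ℓ).image e) T := by
  simp only [IsGreatest, mem_upperBounds, mem_coe, mem_positions, disjoint_left, forall_mem_image,
    mem_Ioi, ← not_le]
  exact and_congr_right fun _ => forall_congr' fun τ => not_imp_not.symm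

lemma sum_erase_positions [LocallyFiniteOrderBot ι] (hℓ : IsGreatest (positions e T : Set ι) ℓ)
    (c : ι → ℝ) :
    ∑ τ ∈ (positions e T).erase ℓ, c τ = ∑ τ ∈ Iio ℓ, c τ * incidence T (e τ) := by
  have herase : (positions e T).erase ℓ = (Iio ℓ).filter fun τ => e τ ∈ T := by
    ext τ
    simp only [mem_erase, mem_filter, mem_Iio, mem_positions]
    exact and_congr_left fun hτ => ⟨(hℓ.2 (mem_positions.2 hτ)).lt_of_ne, LT.lt.ne⟩
  simp [herase, sum_filter, incidence, Set.indicator_apply]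

end Incidence

section Phi

variable {n : ℕ} {u₀ : ℝ} {u : Fin n → ℝ}

lemma rho_eq_marginal (u₀ : ℝ) (u : Fin n → ℝ) (γ : ℕ) : rho u₀ u γ = marginal (Phi u₀ u γ) :=
  rfl

lemma Phi_eq_maxWeight_div (hu₀ : 0 < u₀) (hu : ∀ j, 0 ≤ u j) (γ : ℕ) (S : Finset (Fin n)) :
    Phi u₀ u γ S = maxWeight u γ S / (maxWeight u γ S + u₀) := by
  apply le_antisymm
  · refine sup'_le _ _ fun A hA => ?_
    rw [mem_filter, mem_powerset] at hA
    exact monotoneOn_div_add_const hu₀ (sum_nonneg fun j _ => hu j)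
      (Set.mem_Ici.2 (maxWeight_nonneg S)) (sum_le_maxWeight hA.1 hA.2)
  · obtain ⟨A, hA, hcard, hsum⟩ := exists_sum_eq_maxWeight u γ S
    rw [← hsum]
    exact le_sup' (share u₀ u) (by simp [hA, hcard])

lemma isSubmodular_Phi (hu₀ : 0 < u₀) (hu : ∀ j, 0 ≤ u j) (γ : ℕ) :
    IsSubmodular (Phi u₀ u γ) := by
  rw [funext (Phi_eq_maxWeight_div hu₀ hu γ)]
  exact (isSubmodular_maxWeight u γ).concaveOn_comp monotone_maxWeight (isUpperSet_Ici 0)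
    (fun A => Set.mem_Ici.2 (maxWeight_nonneg A)) (concaveOn_div_add_const hu₀)
    (monotoneOn_div_add_const hu₀)

lemma phi_incidence (hu₀ : 0 < u₀) (hu : ∀ j, 0 ≤ u j) (γ : ℕ) (T : Finset (Fin n)) :
    phi u₀ u γ (incidence T) = Phi u₀ u γ T := by
  rw [Phi_eq_maxWeight_div hu₀ hu]
  refine IsGreatest.csSup_eq ⟨?_, ?_⟩
  · obtain ⟨A, hA, hcard, hsum⟩ := exists_sum_eq_maxWeight u γ T
    have hsum_incidence (a : Fin n → ℝ) : ∑ j, a j * incidence A j = ∑ j ∈ A, a j := by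
      rw [sum_mul_incidence, univ_inter]
    refine ⟨incidence A, ?_, fun j => ?_, fun j => ?_, by rw [hsum_incidence, hsum]⟩
    · simpa using (hsum_incidence 1).trans_le (by simpa using hcard)
    · exact Set.indicator_le_indicator_of_subset (coe_subset.2 hA) (fun _ => zero_le_one) j
    · exact ⟨Set.indicator_nonneg (fun _ _ => zero_le_one) j,
        Set.indicator_le_self' (fun _ _ => zero_le_one) j⟩
  · rintro r ⟨y, hsum, hyT, hy, rfl⟩
    have hzero : ∀ j ∉ T, y j = 0 := fun j hj =>
      le_antisymm ((hyT j).trans_eq (Set.indicator_of_notMem (mod_cast hj) 1)) (hy j).1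
    have hle : ∑ j, u j * y j ≤ maxWeight u γ T := by
      rw [← sum_subset (subset_univ T) fun j _ hj => by rw [hzero j hj, mul_zero]]
      refine sum_mul_le_maxWeight (fun j _ => hy j) ?_
      rwa [sum_subset (subset_univ T) fun j _ hj => hzero j hj]
    exact monotoneOn_div_add_const hu₀ (sum_nonneg fun j _ => mul_nonneg (hu j) (hy j).1)
      (Set.mem_Ici.2 (maxWeight_nonneg T)) hle

lemma mem_XFix_iff (hu₀ : 0 < u₀) (hu : ∀ j, 0 ≤ u j) (γ : ℕ)
    {S₀ S₁ : Finset (Fin n)} {p : ℝ × (Fin n → ℝ)} :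
    p ∈ XFix u₀ u γ S₀ S₁ ↔
      ∃ T, (Disjoint S₀ T ∧ S₁ ⊆ T) ∧ p.2 = incidence T ∧ p.1 ≤ Phi u₀ u γ T := by
  have hmem (T : Finset (Fin n)) (hT : p.2 = incidence T) : p ∈ XFix u₀ u γ S₀ S₁ ↔
      (Disjoint S₀ T ∧ S₁ ⊆ T) ∧ p.1 ≤ Phi u₀ u γ T := by
    have hzero (j : Fin n) : p.2 j = 0 ↔ j ∉ T := by simp [hT, incidence]
    have hone (j : Fin n) : p.2 j = 1 ↔ j ∈ T := by simp [hT, incidence, Set.indicator_apply]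
    have hphi : phi u₀ u γ p.2 = Phi u₀ u γ T := by rw [hT, phi_incidence hu₀ hu]
    simp only [XFix, X, Set.mem_ofPred_eq, hzero, hone, hphi, disjoint_left, subset_iff]
    tauto
  constructor
  · intro hp
    obtain ⟨T, hT⟩ := exists_incidence_eq hp.1.1
    obtain ⟨hfix, hle⟩ := (hmem T hT.symm).1 hp
    exact ⟨T, hfix, hT.symm, hle⟩
  · rintro ⟨T, hfix, hT, hle⟩
    exact (hmem T hT).2 ⟨hfix, hle⟩

lemma isGreatest_image_XFix_iff (hu₀ : 0 < u₀) (hu : ∀ j, 0 ≤ u j) (γ : ℕ)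
    {S₀ S₁ : Finset (Fin n)} (h : (Fin n → ℝ) → ℝ) {ν : ℝ} :
    IsGreatest ((fun p : ℝ × (Fin n → ℝ) => p.1 - h p.2) '' XFix u₀ u γ S₀ S₁) ν ↔
      IsGreatest ((fun T => Phi u₀ u γ T - h (incidence T)) '' {T | Disjoint S₀ T ∧ S₁ ⊆ T}) ν := by
  have himage : (fun p : ℝ × (Fin n → ℝ) => p.1 - h p.2) '' XFix u₀ u γ S₀ S₁ =
      lowerClosure ((fun T => Phi u₀ u γ T - h (incidence T)) ''
        {T | Disjoint S₀ T ∧ S₁ ⊆ T}) := by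
    ext r
    simp only [Set.mem_image, mem_XFix_iff hu₀ hu, SetLike.mem_coe, mem_lowerClosure,
      Set.mem_ofPred_eq]
    constructor
    · rintro ⟨p, ⟨T, hfix, hT, hle⟩, rfl⟩
      exact ⟨_, ⟨T, hfix, rfl⟩, hT ▸ sub_le_sub_right hle _⟩
    · rintro ⟨_, ⟨T, hfix, rfl⟩, hle⟩
      exact ⟨(r + h (incidence T), incidence T), ⟨T, hfix, rfl, le_sub_iff_add_le.1 hle⟩,
        add_sub_cancel_right _ _⟩
  rw [himage, IsGreatest, IsGreatest, upperBounds_lowerClosure]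
  refine and_congr_left fun hν => ⟨fun hmem => ?_, fun hmem => subset_lowerClosure hmem⟩
  obtain ⟨a, ha, hνa⟩ := mem_lowerClosure.1 hmem
  rwa [hνa.antisymm (hν ha)]

lemma exists_isGreatest_image_XFix_iff (hu₀ : 0 < u₀) (hu : ∀ j, 0 ≤ u j) (γ : ℕ)
    {S₀ S₁ : Finset (Fin n)} (h : (Fin n → ℝ) → ℝ) {c K : ℝ} :
    (∃ ν, IsGreatest ((fun p : ℝ × (Fin n → ℝ) => p.1 - h p.2) '' XFix u₀ u γ S₀ S₁) ν ∧
        c = ν - K) ↔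
      IsGreatest ((fun T => Phi u₀ u γ T - h (incidence T) - K) ''
        {T | Disjoint S₀ T ∧ S₁ ⊆ T}) c := by
  simp only [isGreatest_image_XFix_iff hu₀ hu, eq_sub_iff_add_eq, exists_eq_right']
  simp only [IsGreatest, mem_upperBounds, Set.forall_mem_image]
  simp only [Set.mem_image, sub_le_iff_le_add, sub_eq_iff_eq_add]

end Phi

section Corollary

variable {n : ℕ} {u₀ : ℝ} {u : Fin n → ℝ} {γ : ℕ} {S : Finset (Fin n)}

lemma injective_coe_equiv {m : ℕ} (σ : Fin m ≃ ↥S) : Function.Injective fun τ => (σ τ : Fin n) :=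
  Subtype.val_injective.comp σ.injective

lemma isDownLifting_iff_isLifting (hu₀ : 0 < u₀) (hu : ∀ j, 0 ≤ u j) {σ : Fin #S ≃ ↥S}
    {η : ↥S → ℝ} : IsDownLifting u₀ u γ S σ η ↔
      IsLifting (downExcess (Phi u₀ u γ) S) (fun T => positions (fun τ => (σ τ : Fin n)) Tᶜ)
        (fun τ => -η (σ τ)) := by
  refine forall_congr' fun ℓ => ?_
  have hneg (ν : ℝ) : η (σ ℓ) = Phi u₀ u γ S - ∑ τ ∈ Iio ℓ, η (σ τ) - ν ↔
      -η (σ ℓ) = ν - (Phi u₀ u γ S - ∑ τ ∈ Iio ℓ, η (σ τ)) := by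
    rw [neg_eq_iff_eq_neg, neg_sub]
  simp only [sub_sub (Prod.fst _), hneg]
  rw [exists_isGreatest_image_XFix_iff hu₀ hu γ fun x =>
    ∑ j ∈ Sᶜ, rho u₀ u γ j S * x j + ∑ τ ∈ Iio ℓ, η (σ τ) * x (σ τ)]
  have hfeasible : {T : Finset (Fin n) | Disjoint {(σ ℓ : Fin n)} T ∧
      ((Ioi ℓ).image fun τ => (σ τ : Fin n)) ⊆ T} =
      {T | IsGreatest (positions (fun τ => (σ τ : Fin n)) Tᶜ : Set (Fin #S)) ℓ} := by
    ext T
    simp only [Set.mem_ofPred_eq, isGreatest_positions_iff, disjoint_singleton_left, mem_compl,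
      disjoint_compl_right_iff]
  rw [hfeasible]
  refine Eq.to_iff (congrArg (IsGreatest · _) (Set.image_congr fun T hT => ?_))
  rw [sum_erase_positions hT, downExcess_eq_sub_sum_mul_incidence, rho_eq_marginal]
  simp only [incidence, coe_compl, Set.indicator_compl, Pi.sub_apply, Pi.one_apply, neg_mul,
    sum_neg_distrib, mul_sub, mul_one, sum_sub_distrib]
  ring

lemma isUpLifting_iff_isLifting (hu₀ : 0 < u₀) (hu : ∀ j, 0 ≤ u j) {σ : Fin #Sᶜ ≃ ↥Sᶜ}
    {ζ : ↥Sᶜ → ℝ} : IsUpLifting u₀ u γ S σ ζ ↔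
      IsLifting (upExcess (Phi u₀ u γ) S) (positions fun τ => (σ τ : Fin n)) (ζ ∘ σ) := by
  refine forall_congr' fun ℓ => ?_
  have hneg (ν : ℝ) : -Phi u₀ u γ S + ∑ j ∈ S, rho u₀ u γ j (S.erase j) + ν =
      ν - (Phi u₀ u γ S - ∑ j ∈ S, rho u₀ u γ j (S.erase j)) := by
    ring
  simp only [sub_sub (Prod.fst _), hneg]
  rw [exists_isGreatest_image_XFix_iff hu₀ hu γ fun x =>
    ∑ j ∈ S, rho u₀ u γ j (S.erase j) * x j + ∑ τ ∈ Iio ℓ, ζ (σ τ) * x (σ τ)]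
  have hfeasible : {T : Finset (Fin n) | Disjoint ((Ioi ℓ).image fun τ => (σ τ : Fin n)) T ∧
      {(σ ℓ : Fin n)} ⊆ T} =
      {T | IsGreatest (positions (fun τ => (σ τ : Fin n)) T : Set (Fin #Sᶜ)) ℓ} := by
    ext T
    simp only [Set.mem_ofPred_eq, isGreatest_positions_iff, singleton_subset_iff, and_comm]
  rw [hfeasible]
  refine Eq.to_iff (congrArg (IsGreatest · _) (Set.image_congr fun T hT => ?_))
  rw [sum_erase_positions hT, upExcess_eq_sub_sum_mul_incidence, rho_eq_marginal]
  simp only [Function.comp_apply]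
  ring

theorem existsUnique_isDownLifting (hu₀ : 0 < u₀) (hu : ∀ j, 0 ≤ u j) (σ : Fin #S ≃ ↥S) :
    ∃! η, IsDownLifting u₀ u γ S σ η := by
  have hbij : Function.Bijective fun (η : ↥S → ℝ) τ => -η (σ τ) :=
    ((σ.symm.arrowCongr (Equiv.refl ℝ)).trans (Equiv.neg _)).bijective
  simp only [isDownLifting_iff_isLifting hu₀ hu]
  refine hbij.existsUnique_iff.1 (existsUnique_isLifting _ fun ℓ => ⟨{(σ ℓ : Fin n)}ᶜ, ?_⟩)
  rw [compl_compl]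
  exact isGreatest_positions_singleton (injective_coe_equiv σ) ℓ

theorem existsUnique_isUpLifting (hu₀ : 0 < u₀) (hu : ∀ j, 0 ≤ u j) (σ : Fin #Sᶜ ≃ ↥Sᶜ) :
    ∃! ζ, IsUpLifting u₀ u γ S σ ζ := by
  have hbij : Function.Bijective fun ζ : ↥Sᶜ → ℝ => ζ ∘ σ :=
    (σ.symm.arrowCongr (Equiv.refl ℝ)).bijective
  simp only [isUpLifting_iff_isLifting hu₀ hu]
  exact hbij.existsUnique_iff.1 (existsUnique_isLifting _ fun ℓ =>
    ⟨{(σ ℓ : Fin n)}, isGreatest_positions_singleton (injective_coe_equiv σ) ℓ⟩)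

theorem IsDownLifting.rho_le (hu₀ : 0 < u₀) (hu : ∀ j, 0 ≤ u j) {σ : Fin #S ≃ ↥S} {η : ↥S → ℝ}
    (hη : IsDownLifting u₀ u γ S σ η) (j : ↥S) :
    rho u₀ u γ j (univ.erase (j : Fin n)) ≤ η j := by
  have hΦ := isSubmodular_Phi hu₀ hu γ
  obtain ⟨ℓ, rfl⟩ := σ.surjective j
  rw [← neg_le_neg_iff]
  refine ((isDownLifting_iff_isLifting hu₀ hu).1 hη).coeff_le (ℓ := ℓ) (fun T hT => ?_)
    fun T hT => ⟨insert ↑(σ ℓ) T, ?_, ?_⟩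
  · refine hΦ.downExcess_nonpos fun i hi => ?_
    simpa [mem_positions] using eq_empty_iff_forall_notMem.1 hT (σ.symm ⟨i, hi⟩)
  · rw [compl_insert]
    exact positions_erase (injective_coe_equiv σ) Tᶜ ℓ
  · rw [mem_positions, mem_compl] at hT
    rw [downExcess_sub_downExcess_insert (σ ℓ).2, neg_le_neg_iff]
    exact hΦ (subset_erase.2 ⟨subset_univ T, hT⟩) _ (notMem_erase _ _)

theorem IsUpLifting.le_rho (hu₀ : 0 < u₀) (hu : ∀ j, 0 ≤ u j) {σ : Fin #Sᶜ ≃ ↥Sᶜ} {ζ : ↥Sᶜ → ℝ}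
    (hζ : IsUpLifting u₀ u γ S σ ζ) (j : ↥Sᶜ) : ζ j ≤ rho u₀ u γ j ∅ := by
  have hΦ := isSubmodular_Phi hu₀ hu γ
  obtain ⟨ℓ, rfl⟩ := σ.surjective j
  refine ((isUpLifting_iff_isLifting hu₀ hu).1 hζ).coeff_le (ℓ := ℓ) (fun T hT => ?_)
    fun T hT => ⟨T.erase ↑(σ ℓ), positions_erase (injective_coe_equiv σ) T ℓ, ?_⟩
  · refine hΦ.upExcess_nonpos fun i hi => by_contra fun hiS => ?_
    simpa [mem_positions, hi] using
      eq_empty_iff_forall_notMem.1 hT (σ.symm ⟨i, mem_compl.2 hiS⟩)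
  · rw [mem_positions] at hT
    rw [upExcess_sub_upExcess_erase (mem_compl.1 (σ ℓ).2) hT]
    exact hΦ (empty_subset _) _ (notMem_erase _ _)

lemma liftedSI1_atLeastAsStrong {η : ↥S → ℝ}
    (h : ∀ j : ↥S, rho u₀ u γ j (univ.erase (j : Fin n)) ≤ η j) :
    AtLeastAsStrong (LiftedSI1 u₀ u γ S η) (SI1 u₀ u γ S) := by
  intro w x hx hw
  refine hw.trans (sub_le_sub_left ?_ _)
  rw [← sum_coe_sort S]
  exact sum_le_sum fun j _ => mul_le_mul_of_nonneg_right (h j) (sub_nonneg.2 (hx j).2)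

lemma liftedSI2_atLeastAsStrong {ζ : ↥Sᶜ → ℝ} (h : ∀ j : ↥Sᶜ, ζ j ≤ rho u₀ u γ j ∅) :
    AtLeastAsStrong (LiftedSI2 u₀ u γ S ζ) (SI2 u₀ u γ S) := by
  intro w x hx hw
  rw [SI2, add_sub_right_comm]
  refine hw.trans (add_le_add_right ?_ _)
  rw [← sum_coe_sort Sᶜ]
  exact sum_le_sum fun j _ => mul_le_mul_of_nonneg_right (h j) (hx j).1

end Corollary

end LiftedSubmodular

theorem corollary5 (n : ℕ) (u₀ : ℝ) (hu₀ : 0 < u₀) (u : Fin n → ℝ) (hu : ∀ j, 0 ≤ u j)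
    (γ : ℕ) (hγ : 1 ≤ γ) (S : Finset (Fin n)) :
    (∀ σ : Fin S.card ≃ ↥S,
      (∃! η : ↥S → ℝ, LiftedSubmodular.IsDownLifting u₀ u γ S σ η) ∧
      ∀ η : ↥S → ℝ, LiftedSubmodular.IsDownLifting u₀ u γ S σ η →
        (∀ j : ↥S, LiftedSubmodular.rho u₀ u γ j (Finset.univ.erase (j : Fin n)) ≤ η j) ∧
        LiftedSubmodular.AtLeastAsStrong
          (LiftedSubmodular.LiftedSI1 u₀ u γ S η) (LiftedSubmodular.SI1 u₀ u γ S)) ∧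
    (∀ σ : Fin (Sᶜ).card ≃ ↥(Sᶜ),
      (∃! ζ : ↥(Sᶜ) → ℝ, LiftedSubmodular.IsUpLifting u₀ u γ S σ ζ) ∧
      ∀ ζ : ↥(Sᶜ) → ℝ, LiftedSubmodular.IsUpLifting u₀ u γ S σ ζ →
        (∀ j : ↥(Sᶜ), ζ j ≤ LiftedSubmodular.rho u₀ u γ j ∅) ∧
        LiftedSubmodular.AtLeastAsStrong
          (LiftedSubmodular.LiftedSI2 u₀ u γ S ζ) (LiftedSubmodular.SI2 u₀ u γ S)) := by
  refine ⟨fun σ => ⟨LiftedSubmodular.existsUnique_isDownLifting hu₀ hu σ, fun η hη => ?_⟩,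
    fun σ => ⟨LiftedSubmodular.existsUnique_isUpLifting hu₀ hu σ, fun ζ hζ => ?_⟩⟩
  · have hη_ge := hη.rho_le hu₀ hu
    exact ⟨hη_ge, LiftedSubmodular.liftedSI1_atLeastAsStrong hη_ge⟩
  · have hζ_le := hζ.le_rho hu₀ hu
    exact ⟨hζ_le, LiftedSubmodular.liftedSI2_atLeastAsStrong hζ_le⟩
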